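/- For an integer $n\ge 0$, let $Q_n$ be the $n$-dimensional hypercube: its vertices are the $n$-bit binary strings, and two of them are adjacent when they differ in exactly one position. A $k$-dimensional subcube of $Q_n$ is a vertex set $U\subseteq V(Q_n)$ whose induced subgraph is isomorphic to $Q_k$. For $m\ge 0$, let an $m$-family be a finite set $\mathcal F$ of pairwise vertex-disjoint subcubes of $Q_n$, each of dimension at most $m$, and let $Q_n-\mathcal F$ be the subgraph of $Q_n$ induced by the vertices that lie in no member of $\mathcal F$. The $Q_m$-subcube connectivity $\kappa^{sc}(Q_n;Q_m)$ is the minimum cardinality of an $m$-family $\mathcal F$ such that $Q_n-\mathcal F$ is disconnected. The $Q_m$-subcube fault diameter is $$D^{sc}_f(Q_n;Q_m)=\max\{\operatorname{diam}(Q_n-\mathcal F) : \mathcal F \text{ an } m\text{-family},\ |\mathcal F|\le \kappa^{sc}(Q_n;Q_m)-1\}.$$ **Theorem.** Let $m\ge 0$ and $n\ge m+3$. Then $\kappa^{sc}(Q_n;Q_m)=n-m$ and $D^{sc}_f(Q_n;Q_m)=n+1$. Thus $n+1$ is the largest diameter of a graph obtained from $Q_n$ by removing at most $n-m-1$ pairwise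 vertex-disjoint subcubes of dimension at most $m$. -/

import Mathlib

/-- The `n`-dimensional hypercube `Q_n`: vertices are the `n`-bit strings, and two of them are
adjacent when they differ in exactly one position. -/
def hypercube (n : ℕ) : SimpleGraph (Fin n → Bool) where
  Adj x y := hammingDist x y = 1
  symm := ⟨fun x y h => by rw [hammingDist_comm]; exact h⟩
  loopless := ⟨fun x h => by simp at h⟩

/-- `S_k(Q_n)`: the vertex set `U` spans a `k`-dimensional subcube of `Q_n`, i.e. the subgraph of
`Q_n` induced by `U` is isomorphic to `Q_k`. -/
def IsSubcube (n k : ℕ) (U : Finset (Fin n → Bool)) : Prop :=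
  Nonempty ((hypercube n).induce (U : Set (Fin n → Bool)) ≃g hypercube k)

/-- `F` is a set of pairwise vertex-disjoint subcubes of `Q_n`, each of dimension at most `m`. -/
def IsSubcubeFamily (n m : ℕ) (F : Finset (Finset (Fin n → Bool))) : Prop :=
  (∀ U ∈ F, ∃ k ≤ m, IsSubcube n k U) ∧ ∀ U ∈ F, ∀ W ∈ F, U ≠ W → Disjoint U W

/-- `Q_n - F`: the subgraph of `Q_n` induced by the vertices lying in no member of `F`. -/
def removeFamily (n : ℕ) (F : Finset (Finset (Fin n → Bool))) :
    SimpleGraph {x : Fin n → Bool | ∀ U ∈ F, x ∉ U} :=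
  (hypercube n).induce {x : Fin n → Bool | ∀ U ∈ F, x ∉ U}

/-- The `Q_m`-subcube connectivity `κ^{sc}(Q_n; Q_m)`: the least number of pairwise vertex-disjoint
subcubes of dimension at most `m` whose removal disconnects `Q_n` (`⊤` if there is no such set). -/
noncomputable def subcubeConnectivity (n m : ℕ) : ℕ∞ :=
  ⨅ (F : Finset (Finset (Fin n → Bool)))
    (_ : IsSubcubeFamily n m F ∧ ¬ (removeFamily n F).Preconnected), (F.card : ℕ∞)

/-- The `Q_m`-subcube fault diameter `D_f^{sc}(Q_n; Q_m)`: the largest diameter of a graph obtained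
from `Q_n` by removing fewer than `κ^{sc}(Q_n; Q_m)` pairwise vertex-disjoint subcubes of dimension
at most `m`. Diameters are extended (`⊤` for a disconnected graph), so nothing is hidden by a
default value. -/
noncomputable def subcubeFaultDiam (n m : ℕ) : ℕ∞ :=
  ⨆ (F : Finset (Finset (Fin n → Bool)))
    (_ : IsSubcubeFamily n m F ∧ (F.card : ℕ∞) < subcubeConnectivity n m),
    (removeFamily n F).ediam

/-!
Seen from a vertex `x`, the hypercube is the lattice of sets of coordinates at which a vertex
differs from `x`, and subcubes are intervals `[A, B]` with `#(B \ A)` their dimension.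

A uniformly random maximal chain from `X` to `Y` meets `[A, B]` with probability at most
`1 / (a + b)`, where `a = #(A \ X)` and `b = #(Y \ B)` are positive: it must add these `a` elements
before those `b`. By the union bound some chain avoids any family with fewer than `a + b` members.
If fewer than `n - m` intervals are removed, one goes from `∅` to `D` by `∅ → T → D ∪ T → D`, where
`T` is disjoint from `D` and `#D + 2 * #T ≤ n + 1`. No interval contains `∅` or `D`, so only the
middle segment can meet one. Intervals whose bottom leaves `D` are never met if `T` excludes one
element of each such bottom; among the others, `T` is chosen greedily to leave as many tops as
possible, and the union bound takes care of those that remain.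

Conversely, the `n - m` neighbours of an `m`-dimensional subcube isolate it. If the neighbour in
direction `e` is kept, every walk from the subcube to a vertex with the same bit `e` flips `e` on
leaving the subcube and once more later, which costs two extra steps.
-/

open Finset

section IntervalAvoidance

variable {α ι : Type*} [DecidableEq α]

/-- The probability that a uniformly random maximal chain from `X` to `Y` meets the interval
`[A, B]`, when `X ⊆ Y` and `A ⊆ B ∩ Y`: all of `A \ X` has to be added before any of `Y \ B`. -/
def meetProb (A B X Y : Finset α) : ℚ :=
  if X ⊆ B then ((#(A \ X) + #(Y \ B)).choose #(A \ X) : ℚ)⁻¹ else 0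

lemma meetProb_nonneg (A B X Y : Finset α) : 0 ≤ meetProb A B X Y := by
  unfold meetProb
  split_ifs <;> positivity

lemma meetProb_eq_one {A B X : Finset α} (hX : X ∈ Set.Icc A B) (Y : Finset α) :
    meetProb A B X Y = 1 := by
  simp [meetProb, hX.2, sdiff_eq_empty_iff_subset.mpr hX.1]

lemma add_le_choose {a b : ℕ} (ha : a ≠ 0) (hb : b ≠ 0) : a + b ≤ (a + b).choose a := by
  obtain ⟨k, rfl⟩ := Nat.exists_eq_succ_of_ne_zero ha
  have hk : k + 1 ≤ (k + b).choose k := by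
    simpa using Nat.choose_le_choose k (show k + 1 ≤ k + b by omega)
  have hmul := Nat.add_one_mul_choose_eq (k + b) k
  rw [show k + 1 + b = k + b + 1 by omega]
  nlinarith

lemma meetProb_le_inv {A B X Y : Finset α} (hA : ¬ A ⊆ X) (hB : ¬ Y ⊆ B) :
    meetProb A B X Y ≤ ((#(A \ X) + #(Y \ B) : ℕ) : ℚ)⁻¹ := by
  have ha : #(A \ X) ≠ 0 := by simpa [sdiff_eq_empty_iff_subset]
  have hb : #(Y \ B) ≠ 0 := by simpa [sdiff_eq_empty_iff_subset]
  unfold meetProb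
  split_ifs
  · exact inv_anti₀ (by exact_mod_cast (show 0 < #(A \ X) + #(Y \ B) by omega))
      (by exact_mod_cast add_le_choose ha hb)
  · positivity

lemma inv_choose_pred (k b : ℕ) :
    ((k + b).choose k : ℚ)⁻¹ = ((k + 1 + b).choose (k + 1) : ℚ)⁻¹ * (1 + b / (k + 1 : ℕ)) := by
  have hk : ((k + b).choose k : ℚ) ≠ 0 := mod_cast Nat.choose_ne_zero (by omega)
  have hk' : ((k + 1 + b).choose (k + 1) : ℚ) ≠ 0 := mod_cast Nat.choose_ne_zero (by omega)
  have hmul : ((k + b + 1 : ℕ) : ℚ) * (k + b).choose k =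
      (k + 1 + b).choose (k + 1) * (k + 1 : ℕ) := by
    rw [show k + 1 + b = k + b + 1 by omega]
    exact_mod_cast Nat.add_one_mul_choose_eq (k + b) k
  push_cast at hmul ⊢
  field_simp
  linarith

lemma meetProb_insert {A B X : Finset α} (hAB : A ⊆ B) (hX : X ⊆ B) {u : α} (hu : u ∉ X)
    (Y : Finset α) :
    meetProb A B (insert u X) Y = meetProb A B X Y *
      (1 + (if u ∈ A then (#(Y \ B) / #(A \ X) : ℚ) else 0) - if u ∉ B then 1 else 0) := by
  by_cases huB : u ∈ B
  · have hins : insert u X ⊆ B := insert_subset huB hX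
    simp only [meetProb, hX, hins, huB, not_true, if_true, if_false, sub_zero]
    split_ifs with huA
    · have hcard : #(A \ X) = #(A \ insert u X) + 1 := by
        rw [sdiff_insert, card_erase_add_one (mem_sdiff.mpr ⟨huA, hu⟩)]
      rw [hcard, inv_choose_pred]
    · rw [sdiff_insert_of_notMem huA, add_zero, mul_one]
  · have huA : u ∉ A := fun h => huB (hAB h)
    simp [meetProb, insert_subset_iff, huB, huA]

lemma sum_meetProb_insert_le {A B : Finset α} (hAB : A ⊆ B) (X Y : Finset α) :
    ∑ u ∈ Y \ X, meetProb A B (insert u X) Y ≤ #(Y \ X) * meetProb A B X Y := by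
  by_cases hX : X ⊆ B
  · set a := #(A \ X)
    set b := #(Y \ B)
    have hin : (#{u ∈ Y \ X | u ∈ A} : ℚ) * (b / a) ≤ b := by
      have hle : #{u ∈ Y \ X | u ∈ A} ≤ a := card_le_card fun u => by
        simp only [mem_filter, mem_sdiff]
        tauto
      calc (#{u ∈ Y \ X | u ∈ A} : ℚ) * (b / a) ≤ a * (b / a) := by gcongr
        _ ≤ b := by
          rw [← mul_div_assoc]
          exact div_le_of_le_mul₀ (by positivity) (by positivity) (mul_comm ..).le
    have hout : {u ∈ Y \ X | u ∉ B} = Y \ B := by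
      ext u
      have := @hX u
      simp only [mem_filter, mem_sdiff]
      tauto
    calc ∑ u ∈ Y \ X, meetProb A B (insert u X) Y
        = ∑ u ∈ Y \ X, meetProb A B X Y *
            (1 + (if u ∈ A then (b / a : ℚ) else 0) - if u ∉ B then 1 else 0) :=
          sum_congr rfl fun u hu => meetProb_insert hAB hX (mem_sdiff.mp hu).2 Y
      _ = meetProb A B X Y * (#(Y \ X) + #{u ∈ Y \ X | u ∈ A} * (b / a) - b) := by
          rw [← mul_sum, sum_sub_distrib, sum_add_distrib, ← sum_filter, ← sum_filter, hout]
          simp [b]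
      _ ≤ meetProb A B X Y * #(Y \ X) := by
          gcongr
          · exact meetProb_nonneg ..
          · linarith
      _ = #(Y \ X) * meetProb A B X Y := mul_comm ..
  · simp [meetProb, insert_subset_iff, hX]

lemma notMem_Icc_of_sum_meetProb_lt_one {A B : ι → Finset α} {K : Finset ι} {X Y : Finset α}
    (hsum : ∑ j ∈ K, meetProb (A j) (B j) X Y < 1) : ∀ j ∈ K, X ∉ Set.Icc (A j) (B j) :=
  fun _ hj hmem => hsum.not_ge <| meetProb_eq_one hmem Y ▸
    single_le_sum (f := fun i => meetProb (A i) (B i) X Y) (fun _ _ => meetProb_nonneg ..) hj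

theorem exists_walk_avoiding_of_sum_lt_one {A B : ι → Finset α} {K : Finset ι}
    (hAB : ∀ j ∈ K, A j ⊆ B j) {X Y : Finset α} (hXY : X ⊆ Y)
    (hsum : ∑ j ∈ K, meetProb (A j) (B j) X Y < 1) :
    ∃ p : (SimpleGraph.hasse (Finset α)).Walk X Y, p.length = #(Y \ X) ∧
      ∀ S ∈ p.support, S ∈ Set.Icc X Y ∧ ∀ j ∈ K, S ∉ Set.Icc (A j) (B j) := by
  induction hd : #(Y \ X) generalizing X with
  | zero =>
    obtain rfl := hXY.antisymm (sdiff_eq_empty_iff_subset.mp (card_eq_zero.mp hd))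
    exact ⟨.nil, by simp, by simpa using notMem_Icc_of_sum_meetProb_lt_one hsum⟩
  | succ d ih =>
    -- Averaging over the element added next: the expected number of intervals met does not grow.
    obtain ⟨u, hu, hlt⟩ : ∃ u ∈ Y \ X, ∑ j ∈ K, meetProb (A j) (B j) (insert u X) Y < 1 := by
      refine exists_lt_of_sum_lt (g := fun _ => (1 : ℚ)) ?_
      have hpos : (0 : ℚ) < #(Y \ X) := by rw [hd]; positivity
      calc ∑ u ∈ Y \ X, ∑ j ∈ K, meetProb (A j) (B j) (insert u X) Y
          = ∑ j ∈ K, ∑ u ∈ Y \ X, meetProb (A j) (B j) (insert u X) Y := sum_comm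
        _ ≤ ∑ j ∈ K, #(Y \ X) * meetProb (A j) (B j) X Y :=
            sum_le_sum fun j hj => sum_meetProb_insert_le (hAB j hj) X Y
        _ = #(Y \ X) * ∑ j ∈ K, meetProb (A j) (B j) X Y := (mul_sum ..).symm
        _ < #(Y \ X) * 1 := by gcongr
        _ = ∑ _u ∈ Y \ X, (1 : ℚ) := by simp
    obtain ⟨huY, huX⟩ := mem_sdiff.mp hu
    have hd' : #(Y \ insert u X) = d := by
      rw [sdiff_insert, card_erase_of_mem hu, hd, Nat.add_sub_cancel]
    have hadj : (SimpleGraph.hasse (Finset α)).Adj X (insert u X) := .inl (covBy_insert huX)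
    obtain ⟨p, hp, hpav⟩ := ih (insert_subset huY hXY) hlt hd'
    refine ⟨.cons hadj p, by rw [SimpleGraph.Walk.length_cons, hp], fun S hS => ?_⟩
    rcases List.mem_cons.mp (SimpleGraph.Walk.support_cons hadj p ▸ hS) with rfl | hS
    · exact ⟨⟨subset_rfl, hXY⟩, notMem_Icc_of_sum_meetProb_lt_one hsum⟩
    · obtain ⟨hIcc, hav⟩ := hpav S hS
      exact ⟨⟨(subset_insert u X).trans hIcc.1, hIcc.2⟩, hav⟩

theorem exists_walk_avoiding {A B : ι → Finset α} {K : Finset ι} (hAB : ∀ j ∈ K, A j ⊆ B j)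
    {X Y : Finset α} (hXY : X ⊆ Y)
    (hK : ∀ j ∈ K, ¬ A j ⊆ X ∧ ¬ Y ⊆ B j ∧ #K < #(A j \ X) + #(Y \ B j)) :
    ∃ p : (SimpleGraph.hasse (Finset α)).Walk X Y, p.length = #(Y \ X) ∧
      ∀ S ∈ p.support, S ∈ Set.Icc X Y ∧ ∀ j ∈ K, S ∉ Set.Icc (A j) (B j) := by
  refine exists_walk_avoiding_of_sum_lt_one hAB hXY ?_
  calc ∑ j ∈ K, meetProb (A j) (B j) X Y
      ≤ ∑ _j ∈ K, ((#K + 1 : ℕ) : ℚ)⁻¹ := by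
        refine sum_le_sum fun j hj => ?_
        obtain ⟨hA, hB, hlt⟩ := hK j hj
        exact (meetProb_le_inv hA hB).trans (inv_anti₀ (by positivity) (mod_cast hlt))
    _ = #K / (#K + 1 : ℕ) := by rw [sum_const, nsmul_eq_mul, div_eq_mul_inv]
    _ < 1 := by
        rw [div_lt_one (by positivity)]
        exact_mod_cast Nat.lt_succ_self _

end IntervalAvoidance

section Detour

variable {α ι : Type*} [DecidableEq α]

lemma exists_hitting_set (C : ι → Finset α) (K : Finset ι) (t : ℕ) :
    ∃ T ⊆ K.biUnion C, #T ≤ t ∧ #T + #{j ∈ K | Disjoint (C j) T} ≤ #K ∧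
      (#T = t ∨ ∀ j ∈ K, Disjoint (C j) T → C j = ∅) := by
  induction t with
  | zero => exact ⟨∅, by simp, by simp, by simp, by simp⟩
  | succ t ih =>
    obtain ⟨T, hTC, hTt, hTK, hT⟩ := ih
    by_cases hdone : ∀ j ∈ K, Disjoint (C j) T → C j = ∅
    · exact ⟨T, hTC, by omega, hTK, .inr hdone⟩
    have hTt := hT.resolve_right hdone
    push Not at hdone
    obtain ⟨j, hj, hjT, a, ha⟩ := hdone
    have hcard : #(insert a T) = #T + 1 := card_insert_of_notMem (disjoint_left.mp hjT ha)
    refine ⟨insert a T, insert_subset (mem_biUnion.mpr ⟨j, hj, ha⟩) hTC, by omega, ?_,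
      .inl (by omega)⟩
    have hlt : #{i ∈ K | Disjoint (C i) (insert a T)} < #{i ∈ K | Disjoint (C i) T} := by
      refine card_lt_card (ssubset_iff_of_subset (monotone_filter_right K fun i _ h =>
        h.mono_right (subset_insert a T)) |>.mpr ⟨j, by simp [hj, hjT], by simp [ha]⟩)
    omega

lemma exists_disjoint_forall_subset (A : ι → Finset α) (K : Finset ι) (D : Finset α) :
    ∃ R, Disjoint D R ∧ #R + #{j ∈ K | A j ⊆ D} ≤ #K ∧
      ∀ j ∈ K, Disjoint (A j) R → A j ⊆ D := by
  obtain ⟨R, hRA, -, hRK, hR⟩ := exists_hitting_set (fun j => A j \ D) K (#K + 1)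
  have hRD : Disjoint D R := disjoint_of_subset_right hRA <|
    (disjoint_biUnion_right ..).mpr fun _ _ => disjoint_sdiff
  have hdisj : ∀ j, Disjoint (A j \ D) R ↔ Disjoint (A j) R := fun j => by
    rw [disjoint_sdiff_comm, sdiff_eq_self_of_disjoint hRD.symm]
  simp only [hdisj, sdiff_eq_empty_iff_subset] at hRK hR
  replace hR := hR.resolve_left (by omega)
  rw [filter_congr fun j hj => ⟨hR j hj, hRD.mono_left⟩] at hRK
  exact ⟨R, hRD, hRK, hR⟩

lemma exists_subset_card_sdiff_le (B : ι → Finset α) (K : Finset ι) (J : Finset α) :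
    ∃ T ⊆ J, 2 * #T ≤ #J + 1 ∧
      ∀ j ∈ K, T ⊆ B j → #{i ∈ K | T ⊆ B i} + #(J \ B j) ≤ #K := by
  obtain ⟨T, hTB, hTle, hTK, hT⟩ := exists_hitting_set (fun j => J \ B j) K ((#J + 1) / 2)
  have hTJ : T ⊆ J := hTB.trans (biUnion_subset.mpr fun _ _ => sdiff_subset)
  have hdisj : ∀ j, Disjoint (J \ B j) T ↔ T ⊆ B j := fun j => by
    grind [disjoint_left]
  simp only [hdisj] at hTK hT
  refine ⟨T, hTJ, by omega, fun j hj hjT => ?_⟩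
  rcases hT with hT | hT
  · have hle : #(J \ B j) ≤ #J - #T := by
      rw [← card_sdiff_of_subset hTJ]
      exact card_le_card (sdiff_subset_sdiff subset_rfl hjT)
    omega
  · rw [hT j hj hjT, card_empty]
    omega

/-- When `A ⊆ D`, the first three terms on the right add up to the codimension of `[A, B]` in the
lattice of subsets of `D ∪ J`. -/
lemma card_add_card_le (A B : Finset α) {D J : Finset α} (hDJ : Disjoint D J) :
    #D + #J ≤ #A + #(D \ B) + #(J \ B) + #(B \ A) := by
  have hsub : D ∪ J ⊆ A ∪ D \ B ∪ J \ B ∪ B \ A := by grind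
  rw [← card_union_of_disjoint hDJ]
  grw [hsub, card_union_le, card_union_le, card_union_le]

lemma exists_detour_apex [Fintype α] (A B : ι → Finset α) {K : Finset ι}
    (hK : ∀ j ∈ K, #K + #(B j \ A j) < Fintype.card α) (D : Finset α) :
    ∃ T, Disjoint D T ∧ #D + 2 * #T ≤ Fintype.card α + 1 ∧
      (∀ j ∈ K, A j ⊆ D ∪ T → A j ⊆ D) ∧
      ∀ j ∈ K, A j ⊆ D → T ⊆ B j →
        #{i ∈ K | A i ⊆ D ∧ T ⊆ B i} < #(A j) + #(D \ B j) := by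
  obtain ⟨R, hDR, hRK, hAD⟩ := exists_disjoint_forall_subset A K D
  obtain ⟨T, hTJ, hTle, hTK⟩ :=
    exists_subset_card_sdiff_le B {j ∈ K | A j ⊆ D} (D ∪ R)ᶜ
  have hcard : #D + #R + #(D ∪ R)ᶜ = Fintype.card α := by
    rw [← card_union_of_disjoint hDR, card_add_card_compl]
  have hDJ : Disjoint D (D ∪ R)ᶜ := disjoint_compl_right.mono_left subset_union_left
  have hTR : Disjoint (D ∪ T) R :=
    hDR.sup_left (disjoint_compl_left.mono hTJ subset_union_right)
  refine ⟨T, hDJ.mono_right hTJ, by omega, fun j hj h => hAD j hj (hTR.mono_left h),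
    fun j hj hjD hjT => ?_⟩
  have := card_add_card_le (A j) (B j) hDJ
  have := hTK j (mem_filter.mpr ⟨hj, hjD⟩) hjT
  rw [filter_filter] at this
  have := hK j hj
  omega

theorem exists_detour [Fintype α] {A B : ι → Finset α} {K : Finset ι} (hAB : ∀ j ∈ K, A j ⊆ B j)
    (hK : ∀ j ∈ K, #K + #(B j \ A j) < Fintype.card α) {D : Finset α}
    (hbot : ∀ j ∈ K, ∅ ∉ Set.Icc (A j) (B j)) (hD : ∀ j ∈ K, D ∉ Set.Icc (A j) (B j)) :
    ∃ p : (SimpleGraph.hasse (Finset α)).Walk ∅ D, p.length ≤ Fintype.card α + 1 ∧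
      ∀ S ∈ p.support, ∀ j ∈ K, S ∉ Set.Icc (A j) (B j) := by
  obtain ⟨T, hDT, hTle, hAD, hTK⟩ := exists_detour_apex A B hK D
  have hmid : ∀ j ∈ ({j ∈ K | A j ⊆ D ∧ T ⊆ B j} : Finset ι), ¬ A j ⊆ T ∧ ¬ D ∪ T ⊆ B j ∧
      #{j ∈ K | A j ⊆ D ∧ T ⊆ B j} < #(A j \ T) + #((D ∪ T) \ B j) := by
    intro j hj
    obtain ⟨hjK, hjD, hjT⟩ := mem_filter.mp hj
    have hne : A j ≠ ∅ := fun h => hbot j hjK (by simp [h])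
    have hAT : Disjoint (A j) T := hDT.mono_left hjD
    refine ⟨fun h => hne (hAT.eq_bot_of_le h), fun h => hD j hjK ⟨hjD, union_subset_left h⟩, ?_⟩
    rw [sdiff_eq_self_of_disjoint hAT, union_sdiff_distrib, sdiff_eq_empty_iff_subset.mpr hjT,
      union_empty]
    exact hTK j hjK hjD hjT
  -- Go `∅ → T → D ∪ T → D`: below `T` and above `D` no interval can be met.
  obtain ⟨p₁, hp₁, hav₁⟩ := exists_walk_avoiding (A := A) (B := B) (K := ∅) (by simp)
    (empty_subset T) (by simp)
  obtain ⟨p₂, hp₂, hav₂⟩ := exists_walk_avoiding (fun j hj => hAB j (filter_subset _ _ hj))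
    (subset_union_right : T ⊆ D ∪ T) hmid
  obtain ⟨p₃, hp₃, hav₃⟩ := exists_walk_avoiding (A := A) (B := B) (K := ∅) (by simp)
    (subset_union_left : D ⊆ D ∪ T) (by simp)
  refine ⟨(p₁.append p₂).append p₃.reverse, ?_, fun S hS j hj hSj => ?_⟩
  · simp only [SimpleGraph.Walk.length_append, SimpleGraph.Walk.length_reverse, hp₁, hp₂, hp₃,
      sdiff_empty, union_sdiff_cancel_left hDT, union_sdiff_cancel_right hDT]
    omega
  have hjD : S ⊆ D ∪ T → A j ⊆ D := fun h => hAD j hj (hSj.1.trans h)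
  simp only [SimpleGraph.Walk.mem_support_append_iff, SimpleGraph.Walk.support_reverse,
    List.mem_reverse] at hS
  rcases hS with (hS | hS) | hS
  · obtain ⟨⟨-, hST⟩, -⟩ := hav₁ S hS
    refine hbot j hj ⟨hDT (hjD ?_) (hSj.1.trans hST), empty_subset _⟩
    exact hST.trans subset_union_right
  · obtain ⟨⟨hTS, hS'⟩, hav⟩ := hav₂ S hS
    exact hav j (mem_filter.mpr ⟨hj, hjD hS', hTS.trans hSj.2⟩) hSj
  · obtain ⟨⟨hDS, hS'⟩, -⟩ := hav₃ S hS
    exact hD j hj ⟨hjD hS', hDS.trans hSj.2⟩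

end Detour

section Subcubes

variable {n : ℕ}

/-- The vertex of the hypercube obtained from `x` by flipping the bits in `S`. Based at `x`, this
identifies the hypercube with the lattice of sets of coordinates. -/
def flipOn (x : Fin n → Bool) (S : Finset (Fin n)) : Fin n → Bool :=
  fun i => x i ^^ decide (i ∈ S)

lemma flipOn_apply_eq_iff {x : Fin n → Bool} {S T : Finset (Fin n)} {i : Fin n} :
    flipOn x S i = flipOn x T i ↔ (i ∈ S ↔ i ∈ T) := by
  simp [flipOn]

@[simp] lemma flipOn_empty (x : Fin n → Bool) : flipOn x ∅ = x := by
  ext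
  simp [flipOn]

lemma exists_flipOn_eq (x y : Fin n → Bool) : ∃ S, flipOn x S = y :=
  ⟨univ.filter fun i => x i ≠ y i, by ext i; cases hx : x i <;> cases hy : y i <;> simp [flipOn, *]⟩

lemma hammingDist_flipOn (x : Fin n → Bool) (S T : Finset (Fin n)) :
    hammingDist (flipOn x S) (flipOn x T) = #(symmDiff S T) := by
  unfold hammingDist
  congr 1
  ext i
  simp only [mem_filter_univ, ne_eq, flipOn_apply_eq_iff, mem_symmDiff]
  tauto

lemma flipOn_injective (x : Fin n → Bool) : Function.Injective (flipOn x) := fun S T h => by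
  ext i
  exact flipOn_apply_eq_iff.mp (congrFun h i)

/-- `flipOn x` as a homomorphism from the Hasse diagram of the lattice of coordinate sets. -/
def flipHom (x : Fin n → Bool) : SimpleGraph.hasse (Finset (Fin n)) →g hypercube n where
  toFun := flipOn x
  map_rel' {S T} h := by
    change hammingDist _ _ = 1
    rw [hammingDist_flipOn]
    rcases h with h | h
    · rw [symmDiff_of_le h.le, (covBy_iff_card_sdiff_eq_one.mp h).2]
    · rw [symmDiff_of_ge h.le, (covBy_iff_card_sdiff_eq_one.mp h).2]

/-- The coordinate cube through `p` with free coordinates `R`. -/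
def coordCube (p : Fin n → Bool) (R : Finset (Fin n)) : Finset (Fin n → Bool) :=
  univ.filter fun z => ∀ i ∉ R, z i = p i

lemma mem_coordCube {p z : Fin n → Bool} {R : Finset (Fin n)} :
    z ∈ coordCube p R ↔ ∀ i ∉ R, z i = p i := by
  simp [coordCube]

lemma flipOn_mem_coordCube {x : Fin n → Bool} {R S T : Finset (Fin n)} :
    flipOn x S ∈ coordCube (flipOn x T) R ↔ S ∈ Set.Icc (T \ R) (T ∪ R) := by
  simp only [mem_coordCube, flipOn_apply_eq_iff, Set.mem_Icc, subset_iff, mem_sdiff,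
    mem_union]
  grind

lemma hypercube_adj_iff {x y : Fin n → Bool} :
    (hypercube n).Adj x y ↔ ∃ i, x i ≠ y i ∧ ∀ j ≠ i, x j = y j := by
  change #{i | x i ≠ y i} = 1 ↔ _
  simp only [card_eq_one, eq_singleton_iff_unique_mem, mem_filter_univ, ne_eq, not_imp_comm]

lemma mem_coordCube_of_adj {p a b c : Fin n → Bool} {R : Finset (Fin n)}
    (ha : a ∈ coordCube p R) (hb : b ∈ coordCube p R) (hab : a ≠ b)
    (hac : (hypercube n).Adj a c) (hbc : (hypercube n).Adj b c) : c ∈ coordCube p R := by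
  rw [mem_coordCube] at *
  obtain ⟨s, -, hs⟩ := hypercube_adj_iff.mp hac
  obtain ⟨t, -, ht⟩ := hypercube_adj_iff.mp hbc
  intro i hi
  by_contra hne
  have his : i = s := by grind
  have hit : i = t := by grind
  exact hab (funext fun j => by grind)

theorem exists_coordCube_of_injective {α : Type*} [Fintype α]
    (f : SimpleGraph.hasse (Finset α) →g hypercube n) (hf : Function.Injective f) :
    ∃ R, #R ≤ Fintype.card α ∧ ∀ s, f s ∈ coordCube (f ∅) R := by
  classical
  have hadj : ∀ {s : Finset α} {a}, a ∈ s → (hypercube n).Adj (f (s.erase a)) (f s) := fun ha =>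
    f.map_adj (.inl (erase_covBy ha))
  have hdir : ∀ a, ∃ c, ∀ i ≠ c, f ∅ i = f {a} i := fun a => by
    obtain ⟨c, -, hc⟩ := hypercube_adj_iff.mp (hadj (mem_singleton_self a))
    exact ⟨c, by simpa using hc⟩
  choose c hc using hdir
  refine ⟨univ.image c, card_image_le, fun s => ?_⟩
  induction s using Finset.strongInduction with | _ s ih
  rcases s.eq_empty_or_nonempty with rfl | hs
  · simp [mem_coordCube]
  rcases hs.exists_eq_singleton_or_nontrivial with ⟨a, rfl⟩ | ⟨a, ha, b, hb, hab⟩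
  · exact mem_coordCube.mpr fun i hi => (hc a i fun h => hi (by simp [h])).symm
  · refine mem_coordCube_of_adj (ih _ (erase_ssubset ha)) (ih _ (erase_ssubset hb))
      (fun h => ?_) (hadj ha) (hadj hb)
    exact notMem_erase a s (hf h ▸ mem_erase.mpr ⟨hab, ha⟩)

/-- The vertices of a coordinate cube are determined by their free coordinates. -/
noncomputable def coordCubeEquiv (p : Fin n → Bool) (R : Finset (Fin n)) :
    (coordCube p R : Set (Fin n → Bool)) ≃ (Fin #R → Bool) where
  toFun z := z.1 ∘ R.orderEmbOfFin rfl
  invFun w := ⟨Function.extend (R.orderEmbOfFin rfl) w p, by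
    rw [mem_coe, mem_coordCube]
    intro i hi
    exact Function.extend_apply' _ _ _ (by simpa [← Set.mem_range])⟩
  left_inv z := by
    ext i
    by_cases hi : i ∈ Set.range (R.orderEmbOfFin rfl)
    · obtain ⟨j, rfl⟩ := hi
      exact (R.orderEmbOfFin rfl).injective.extend_apply ..
    · change Function.extend _ _ _ i = _
      rw [Function.extend_apply' _ _ _ hi, mem_coordCube.mp z.2 i (by simpa using hi)]
  right_inv w := Function.extend_comp (R.orderEmbOfFin rfl).injective ..

theorem isSubcube_coordCube (p : Fin n → Bool) (R : Finset (Fin n)) :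
    IsSubcube n #R (coordCube p R) := by
  refine ⟨coordCubeEquiv p R, fun {z w} => ?_⟩
  have hdist : hammingDist (coordCubeEquiv p R z) (coordCubeEquiv p R w) =
      hammingDist z.1 w.1 := by
    unfold hammingDist
    rw [← card_map (R.orderEmbOfFin rfl).toEmbedding]
    congr 1
    ext i
    have hi : z.1 i ≠ w.1 i → i ∈ R := fun h => by_contra fun hi =>
      h ((mem_coordCube.mp z.2 i hi).trans (mem_coordCube.mp w.2 i hi).symm)
    have hr : i ∈ R ↔ ∃ j, R.orderEmbOfFin rfl j = i := by simp [← Set.mem_range]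
    simp only [mem_map, mem_filter_univ, coordCubeEquiv, Equiv.coe_fn_mk, Function.comp_apply,
      RelEmbedding.coe_toEmbedding]
    grind
  change hammingDist _ _ = 1 ↔ hammingDist _ _ = 1
  rw [hdist]
  rfl

lemma IsSubcube.card_eq {k : ℕ} {U : Finset (Fin n → Bool)} (h : IsSubcube n k U) :
    #U = 2 ^ k := by
  obtain ⟨e⟩ := h
  simpa using Fintype.card_congr e.toEquiv

theorem IsSubcube.exists_eq_coordCube {k : ℕ} {U : Finset (Fin n → Bool)} (h : IsSubcube n k U) :
    ∃ p R, #R ≤ k ∧ U = coordCube p R := by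
  have hU := h.card_eq
  obtain ⟨e⟩ := h
  let f : SimpleGraph.hasse (Finset (Fin k)) →g hypercube n :=
    (SimpleGraph.Embedding.induce _).toHom.comp (e.symm.toHom.comp (flipHom fun _ => false))
  have hf : Function.Injective f :=
    Subtype.val_injective.comp (e.symm.injective.comp (flipOn_injective _))
  have himage : univ.image f = U := by
    refine eq_of_subset_of_card_le (image_subset_iff.mpr fun s _ => (e.symm _).2) ?_
    simp [card_image_of_injective _ hf, hU]
  obtain ⟨R, hR, hmem⟩ := exists_coordCube_of_injective f hf
  rw [Fintype.card_fin] at hR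
  refine ⟨f ∅, R, hR, ?_⟩
  refine eq_of_subset_of_card_le (himage ▸ image_subset_iff.mpr fun s _ => hmem s) ?_
  rw [hU, (isSubcube_coordCube _ R).card_eq]
  gcongr
  norm_num

lemma IsSubcube.exists_flipOn_mem_iff {k : ℕ} {U : Finset (Fin n → Bool)} (h : IsSubcube n k U)
    (x : Fin n → Bool) :
    ∃ A B, A ⊆ B ∧ #(B \ A) ≤ k ∧ ∀ S, flipOn x S ∈ U ↔ S ∈ Set.Icc A B := by
  obtain ⟨p, R, hR, rfl⟩ := h.exists_eq_coordCube
  obtain ⟨T, rfl⟩ := exists_flipOn_eq x p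
  have hsub : (T ∪ R) \ (T \ R) ⊆ R := by grind
  exact ⟨T \ R, T ∪ R, sdiff_subset.trans subset_union_left, (card_le_card hsub).trans hR,
    fun S => flipOn_mem_coordCube⟩

end Subcubes

section UpperBound

lemma edist_induce_le {V : Type*} {G : SimpleGraph V} {s : Set V} {u v : V} (p : G.Walk u v)
    (hp : ∀ w ∈ p.support, w ∈ s) :
    (G.induce s).edist ⟨u, hp u p.start_mem_support⟩ ⟨v, hp v p.end_mem_support⟩ ≤ p.length := by
  have hlength : (p.induce s hp).length = p.length :=
    (SimpleGraph.Walk.length_map ..).symm.trans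
      (congrArg SimpleGraph.Walk.length (p.map_induce hp))
  exact hlength ▸ SimpleGraph.edist_le (p.induce s hp)

variable {n m : ℕ} {F : Finset (Finset (Fin n → Bool))}

theorem edist_removeFamily_le (hF : ∀ U ∈ F, ∃ k ≤ m, IsSubcube n k U) (hcard : #F + m < n)
    (x y : {x : Fin n → Bool | ∀ U ∈ F, x ∉ U}) :
    (removeFamily n F).edist x y ≤ (n + 1 : ℕ) := by
  obtain ⟨x, hx⟩ := x
  obtain ⟨y, hy⟩ := y
  obtain ⟨D, hD⟩ := exists_flipOn_eq x y
  have hinterval : ∀ U ∈ F, ∃ A B, A ⊆ B ∧ #(B \ A) ≤ m ∧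
      ∀ S, flipOn x S ∈ U ↔ S ∈ Set.Icc A B := fun U hU => by
    obtain ⟨k, hk, hU⟩ := hF U hU
    obtain ⟨A, B, hAB, hBA, hmem⟩ := hU.exists_flipOn_mem_iff x
    exact ⟨A, B, hAB, hBA.trans hk, hmem⟩
  choose! A B hAB hBA hmem using hinterval
  obtain ⟨p, hp, hav⟩ := exists_detour (K := F) (D := D) hAB
    (fun U hU => by have := hBA U hU; rw [Fintype.card_fin]; omega)
    (fun U hU => (hmem U hU ∅).not.mp (by simpa using hx U hU))
    (fun U hU => (hmem U hU D).not.mp (by simpa [hD] using hy U hU))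
  rw [Fintype.card_fin] at hp
  have hx' : flipHom x ∅ = x := flipOn_empty x
  have hy' : flipHom x D = y := hD
  let q := (p.map (flipHom x)).copy hx' hy'
  have hq : ∀ z ∈ q.support, ∀ U ∈ F, z ∉ U := by
    intro z hz U hU
    obtain ⟨S, hS, rfl⟩ : ∃ S ∈ p.support, flipHom x S = z := by simpa [q] using hz
    exact (hmem U hU S).not.mpr (hav S hS U hU)
  calc (removeFamily n F).edist ⟨x, hx⟩ ⟨y, hy⟩ ≤ q.length := edist_induce_le q hq
    _ ≤ (n + 1 : ℕ) := by simpa [q] using mod_cast hp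

theorem le_subcubeConnectivity (n m : ℕ) : ((n - m : ℕ) : ℕ∞) ≤ subcubeConnectivity n m := by
  refine le_iInf₂ fun F hF => ?_
  norm_cast
  by_contra! hlt
  refine hF.2 fun x y => SimpleGraph.edist_ne_top_iff_reachable.mp ?_
  exact ne_top_of_le_ne_top (ENat.natCast_ne_top _)
    (edist_removeFamily_le hF.1.1 (by omega) x y)

end UpperBound

section LowerBound

variable {n : ℕ} {p : Fin n → Bool} {R S : Finset (Fin n)}

/-- The neighbours of the cube `coordCube p R` in the directions of `S`. -/
def neighborCubes (p : Fin n → Bool) (R S : Finset (Fin n)) : Finset (Finset (Fin n → Bool)) :=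
  S.image fun i => coordCube (flipOn p {i}) R

lemma flipOn_mem_coordCube_self {T : Finset (Fin n)} :
    flipOn p T ∈ coordCube p R ↔ T ⊆ R := by
  simpa using flipOn_mem_coordCube (x := p) (R := R) (S := T) (T := ∅)

lemma flipOn_mem_coordCube_flipOn_singleton {i : Fin n} (hi : i ∉ R) {T : Finset (Fin n)} :
    flipOn p T ∈ coordCube (flipOn p {i}) R ↔ T \ R = {i} := by
  rw [flipOn_mem_coordCube, Set.mem_Icc, sdiff_eq_self_of_disjoint (by simpa)]
  grind

lemma isSubcubeFamily_neighborCubes (hSR : Disjoint S R) :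
    IsSubcubeFamily n #R (neighborCubes p R S) := by
  simp only [IsSubcubeFamily, neighborCubes, forall_mem_image]
  refine ⟨fun i _ => ⟨#R, le_rfl, isSubcube_coordCube _ R⟩, fun i hi j hj hij => ?_⟩
  rw [disjoint_left]
  intro z hzi hzj
  obtain ⟨T, rfl⟩ := exists_flipOn_eq p z
  rw [flipOn_mem_coordCube_flipOn_singleton (disjoint_left.mp hSR hi)] at hzi
  rw [flipOn_mem_coordCube_flipOn_singleton (disjoint_left.mp hSR hj)] at hzj
  obtain rfl := singleton_injective (hzi.symm.trans hzj)
  exact hij rfl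

lemma notMem_neighborCubes (hSR : Disjoint S R) {T : Finset (Fin n)} (hT : #(T \ R) ≠ 1) :
    ∀ U ∈ neighborCubes p R S, flipOn p T ∉ U := by
  simp only [neighborCubes, forall_mem_image]
  intro i hi hmem
  rw [flipOn_mem_coordCube_flipOn_singleton (disjoint_left.mp hSR hi)] at hmem
  exact hT (hmem ▸ card_singleton i)

lemma exists_mem_coordCube_of_adj {u v : Fin n → Bool} (huv : (hypercube n).Adj u v)
    (hu : u ∈ coordCube p R) (hv : v ∉ coordCube p R) :
    ∃ i ∉ R, v ∈ coordCube (flipOn p {i}) R ∧ v i ≠ u i ∧ ∀ j ≠ i, u j = v j := by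
  obtain ⟨i, hne, hrest⟩ := hypercube_adj_iff.mp huv
  simp only [mem_coordCube] at *
  have hi : i ∉ R := fun hi => hv fun j _ => by grind
  refine ⟨i, hi, fun j hj => ?_, hne.symm, hrest⟩
  simp only [flipOn, ← hu j hj, mem_singleton]
  by_cases hji : j = i
  · subst hji
    simpa using Bool.eq_not.mpr hne.symm
  · simp [hji, hrest j hji]

theorem not_preconnected_removeFamily_neighborCubes (p : Fin n → Bool) (hR : #R + 2 ≤ n) :
    ¬ (removeFamily n (neighborCubes p R Rᶜ)).Preconnected := by
  intro hconn
  have hR' : R ≠ univ := by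
    rintro rfl
    simp at hR
  have hp : ∀ U ∈ neighborCubes p R Rᶜ, p ∉ U := by
    simpa using notMem_neighborCubes (p := p) (R := R) disjoint_compl_left (T := ∅) (by simp)
  have hq : ∀ U ∈ neighborCubes p R Rᶜ, flipOn p univ ∉ U :=
    notMem_neighborCubes disjoint_compl_left (by
      rw [← compl_eq_univ_sdiff, card_compl, Fintype.card_fin]
      omega)
  obtain ⟨w⟩ := hconn ⟨p, hp⟩ ⟨flipOn p univ, hq⟩
  obtain ⟨d, -, hd, hd'⟩ := w.exists_boundary_dart {z | z.1 ∈ coordCube p R}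
    (by simp [mem_coordCube])
    (by simpa [flipOn_mem_coordCube_self, univ_subset_iff] using hR')
  obtain ⟨i, hi, hmem, -⟩ := exists_mem_coordCube_of_adj d.adj hd hd'
  exact d.snd.2 _ (mem_image_of_mem _ (mem_compl.mpr hi)) hmem

theorem subcubeConnectivity_eq {m : ℕ} (hmn : m + 2 ≤ n) :
    subcubeConnectivity n m = ((n - m : ℕ) : ℕ∞) := by
  obtain ⟨R, -, rfl⟩ := exists_subset_card_eq (s := (univ : Finset (Fin n))) (n := m)
    (by rw [card_fin]; omega)
  refine le_antisymm ?_ (le_subcubeConnectivity n #R)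
  refine (iInf₂_le (neighborCubes (fun _ => false) R Rᶜ)
    ⟨isSubcubeFamily_neighborCubes disjoint_compl_left,
      not_preconnected_removeFamily_neighborCubes _ hmn⟩).trans ?_
  grw [neighborCubes, card_image_le, card_compl, Fintype.card_fin]

lemma le_add_edist_of_forall_adj {V : Type*} {G : SimpleGraph V} {h : V → ℕ}
    (hh : ∀ u v, G.Adj u v → h u ≤ h v + 1) (u v : V) : (h u : ℕ∞) ≤ h v + G.edist u v := by
  by_cases hr : G.Reachable u v
  · obtain ⟨p, hp⟩ := hr.exists_walk_length_eq_edist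
    rw [← hp]
    norm_cast
    clear hp hr
    induction p with
    | nil => simp
    | cons hadj p ih =>
      have := hh _ _ hadj
      rw [SimpleGraph.Walk.length_cons]
      omega
  · simp [SimpleGraph.edist_eq_top_of_not_reachable hr]

/-- Hamming distance to `flipOn p {e}ᶜ`, plus a surcharge of `2` on `coordCube p R` for having to
flip the bit `e` on the way out and again outside. -/
def detourPotential (p : Fin n → Bool) (R : Finset (Fin n)) (e : Fin n) (z : Fin n → Bool) : ℕ :=
  hammingDist z (flipOn p {e}ᶜ) + if z ∈ coordCube p R then 2 else 0

lemma detourPotential_le {e : Fin n} {u v : Fin n → Bool}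
    (hv : ∀ U ∈ neighborCubes p R (Rᶜ.erase e), v ∉ U) (huv : (hypercube n).Adj u v) :
    detourPotential p R e u ≤ detourPotential p R e v + 1 := by
  unfold detourPotential
  have hd : hammingDist u v = 1 := huv
  have htri := hammingDist_triangle u v (flipOn p {e}ᶜ)
  by_cases hexit : u ∈ coordCube p R ∧ v ∉ coordCube p R
  · obtain ⟨hu, hv'⟩ := hexit
    obtain ⟨i, hi, hmem, hne, hrest⟩ := exists_mem_coordCube_of_adj huv hu hv'
    obtain rfl : i = e := by
      by_contra hie
      exact hv _ (mem_image_of_mem _ (mem_erase.mpr ⟨hie, mem_compl.mpr hi⟩)) hmem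
    have hui : u i = flipOn p {i}ᶜ i := by simpa [flipOn] using mem_coordCube.mp hu i hi
    have hlt : hammingDist u (flipOn p {i}ᶜ) < hammingDist v (flipOn p {i}ᶜ) := by
      refine card_lt_card ((ssubset_iff_of_subset fun j => ?_).mpr ⟨i, ?_, ?_⟩) <;> grind
    simp only [hu, hv', if_true, if_false]
    omega
  · grind

theorem le_ediam_removeFamily_neighborCubes (p : Fin n → Bool) {e : Fin n} (he : e ∉ R)
    (hR : #R + 3 ≤ n) :
    ((n + 1 : ℕ) : ℕ∞) ≤ (removeFamily n (neighborCubes p R (Rᶜ.erase e))).ediam := by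
  have hdisj : Disjoint (Rᶜ.erase e) R := disjoint_compl_left.mono_left (erase_subset ..)
  have hcard : #({e}ᶜ \ R) + #R + 1 = n := by
    have := card_add_card_compl (insert e R)
    rw [card_insert_of_notMem he, Fintype.card_fin] at this
    rw [show {e}ᶜ \ R = (insert e R)ᶜ by ext; simp]
    omega
  have hp : ∀ U ∈ neighborCubes p R (Rᶜ.erase e), p ∉ U := by
    simpa using notMem_neighborCubes (p := p) hdisj (T := ∅) (by simp)
  have hq : ∀ U ∈ neighborCubes p R (Rᶜ.erase e), flipOn p {e}ᶜ ∉ U :=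
    notMem_neighborCubes hdisj (by omega)
  have hpot : detourPotential p R e p = n + 1 := by
    have hdist := hammingDist_flipOn p ∅ {e}ᶜ
    rw [flipOn_empty, ← bot_eq_empty, bot_symmDiff, card_compl, card_singleton,
      Fintype.card_fin] at hdist
    have hmem : p ∈ coordCube p R := by simp [mem_coordCube]
    simp only [detourPotential, hdist, hmem, if_true]
    omega
  have hpot' : detourPotential p R e (flipOn p {e}ᶜ) = 0 := by
    have hmem : flipOn p {e}ᶜ ∉ coordCube p R := by
      rw [flipOn_mem_coordCube_self, ← sdiff_eq_empty_iff_subset, ← card_eq_zero]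
      omega
    simp [detourPotential, hmem]
  have hle := le_add_edist_of_forall_adj (G := removeFamily n (neighborCubes p R (Rᶜ.erase e)))
    (h := fun z => detourPotential p R e z.1) (fun u v => detourPotential_le v.2) ⟨p, hp⟩
    ⟨flipOn p {e}ᶜ, hq⟩
  rw [hpot, hpot', Nat.cast_zero, zero_add] at hle
  exact hle.trans SimpleGraph.edist_le_ediam

theorem exists_le_ediam_removeFamily {m : ℕ} (hmn : m + 3 ≤ n) :
    ∃ F, IsSubcubeFamily n m F ∧ #F < n - m ∧
      ((n + 1 : ℕ) : ℕ∞) ≤ (removeFamily n F).ediam := by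
  obtain ⟨R, -, rfl⟩ := exists_subset_card_eq (s := (univ : Finset (Fin n))) (n := m)
    (by rw [card_fin]; omega)
  have hcompl : #Rᶜ = n - #R := by rw [card_compl, Fintype.card_fin]
  obtain ⟨e, he⟩ : Rᶜ.Nonempty := card_pos.mp (by omega)
  refine ⟨neighborCubes (fun _ => false) R (Rᶜ.erase e),
    isSubcubeFamily_neighborCubes (disjoint_compl_left.mono_left (erase_subset ..)), ?_,
    le_ediam_removeFamily_neighborCubes _ (mem_compl.mp he) hmn⟩
  exact card_image_le.trans_lt (hcompl ▸ card_erase_lt_of_mem he)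

end LowerBound

theorem theorem3p25 (m n : ℕ) (hn : m + 3 ≤ n) :
    subcubeConnectivity n m = ((n - m : ℕ) : ℕ∞) ∧
      subcubeFaultDiam n m = ((n + 1 : ℕ) : ℕ∞) := by
  have hconn : subcubeConnectivity n m = ((n - m : ℕ) : ℕ∞) := subcubeConnectivity_eq (by omega)
  refine ⟨hconn, le_antisymm (iSup₂_le fun F ⟨hF, hlt⟩ => ?_) ?_⟩
  · rw [hconn, Nat.cast_lt] at hlt
    exact SimpleGraph.ediam_le_of_edist_le (edist_removeFamily_le hF.1 (by omega))
  · obtain ⟨F, hF, hlt, hle⟩ := exists_le_ediam_removeFamily hn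
    exact le_iSup₂_of_le F ⟨hF, by rw [hconn]; exact_mod_cast hlt⟩ hle
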